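/- Throughout, "space" means either always topological space or always approach space, and "map" means continuous map, respectively contraction; the theorem holds in both cases. $U$ is the ultrafilter monad with unit $e$ and multiplication $m$. In the topological case let $\mathsf V=\{\mathsf{false}\sqsubseteq\mathsf{true}\}$ with $\otimes=\&$; in the approach case let $\mathsf V=[0,\infty]$ with $\otimes=+$ and $\sqsubseteq$ the relation $\geqslant$. For a relation $r:X\times Y\to\mathsf V$ put $Ur(\mathfrak x,\mathfrak y)=\bigwedge_{A\in\mathfrak x,B\in\mathfrak y}\bigvee_{x\in A,y\in B}r(x,y)$. A space $X$ is given by its convergence $a:UX\times X\to\mathsf V$ (ultrafilter convergence of a topology, respectively a numerical relation with $0\geqslant a(e_X(x),x)$ and $Ua(\mathfrak X,\mathfrak x)+a(\mathfrak x,x)\geqslant a(m_X(\mathfrak X),x)$). A $\mathbb U$-relation $X\rightharpoonup Y$ is a map $UX\times Y\to\mathsf V$, ordered pointwise by $\sqsubseteq$, and Kleisli composition is $$(s\circ r)(\mathfrak x,z)=\bigvee_{m_X(\mathfrak X)=\mathfrak x}\ \bigvee_{\mathfrak y\in UY}Ur(\mathfrak X,\mathfrak y)\otimes s(\mathfrak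 y,z).$$ The dual $X^{\mathrm{op}}$ of $X=(X,a)$ is the set $UX$ where the convergence of $\mathfrak X$ to $\mathfrak x$ has value $\bigvee_{m_X(\mathfrak Y)=\mathfrak x}Ua(\mathfrak Y,m_X(\mathfrak X))$. The set $\mathsf V$ is a space with convergence $(\mathfrak u,v)\mapsto\hom(\xi(\mathfrak u),v)$, where $\xi(\mathfrak u)=\bigwedge_{A\in\mathfrak u}\bigvee A$ and $\hom(x,-)$ is right adjoint to $x\otimes-$. A $\mathbb U$-module $\varphi:X\rightharpoonup Y$ is a $\mathbb U$-relation that is a map $X^{\mathrm{op}}\otimes Y\to\mathsf V$ (with $\otimes$ the product of topological spaces, respectively the $+$-product of approach spaces). Spaces and $\mathbb U$-modules form a category $\mathrm{Mod}(\mathbb U)$ under Kleisli composition; the identity on $(X,a)$ is $a$. A map $f:X\to(Y,b)$ induces modules $f_*:X\rightharpoonup Y$, $f_*(\mathfrak x,y)=b(Uf(\mathfrak x),y)$, and $f^*:Y\rightharpoonup X$, $f^*(\mathfrak y,x)=b(\mathfrak y,f(x))$; for a point $x$ of $X$, seen as a map $1\to X$ from the one-point space, this gives $x_*:1\rightharpoonup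 X$ and $x^*:X\rightharpoonup 1$. Let $PX$ be the function space $\mathsf V^{X^{\mathrm{op}}}$, whose points are the modules $X\rightharpoonup 1$. A colimit of a map $d:D\to X$ weighted by a module $\psi:D\rightharpoonup 1$ is a point $x\in X$ such that $x_*$ is the largest module $\chi:1\rightharpoonup X$ with $\chi\circ\psi\sqsubseteq d_*$. Let a family $\Phi$ be given that assigns to each space $X$ a set $\Phi[X]$ of $\mathbb U$-modules $X\rightharpoonup 1$ containing all representable modules $x^*$, $x\in X$. Regard $\Phi[X]$ as a subspace of $PX$. Let $\mathrm{Mod}(\Phi)$ be the class of all $\mathbb U$-modules $\varphi:X\rightharpoonup Y$ such that $y^*\circ\varphi\in\Phi[X]$ for every $y\in Y$. **Theorem.** The following assertions are equivalent. 1. The family is saturated: for all spaces $X$ and $D$, every map $d:D\to\Phi[X]$ and every $\psi\in\Phi[D]$, the $\psi$-weighted colimit of $d$ exists in $\Phi[X]$, and the inclusion $i:\Phi[X]\to PX$ preserves it (every such colimit in $\Phi[X]$ is a $\psi$-weighted colimit of $i\cdot d$ in $PX$). 2. $\mathrm{Mod}(\Phi)$ is a subcategory of $\mathrm{Mod}(\mathbb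 U)$: it contains all identity modules and is closed under Kleisli composition. 3. For all spaces $X,Y$ and all $\psi\in\Phi[X]$: $\psi\circ f^*\in\Phi[Y]$ for every map $f:X\to Y$, and $\psi\circ g_*\in\Phi[Y]$ for every map $g:Y\to X$ with $g_*\in\mathrm{Mod}(\Phi)$. -/

import Mathlib

universe u

open scoped ENNReal

/-! ### The two quantales: truth values and distances

The order of a quantale is the order `⊑` of (numerical) relations. For `Prop` it is implication,
with `&` as tensor. For `ℝ≥0∞ᵒᵈ` it is the reversed order of `[0, ∞]`, with `+` as tensor, so that
a supremum in `ℝ≥0∞ᵒᵈ` is an infimum of numbers and vice versa. -/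

/-- Commutative unital quantales. -/
class TruthQuantale (V : Type) [CompleteLattice V] where
  tens : V → V → V
  unit : V
  tens_comm : ∀ a b, tens a b = tens b a
  tens_assoc : ∀ a b c, tens (tens a b) c = tens a (tens b c)
  unit_tens : ∀ a, tens unit a = a
  tens_sSup : ∀ (a : V) (s : Set V), tens a (sSup s) = ⨆ b ∈ s, tens a b

open TruthQuantale

/-- The quantale of truth values. -/
instance instTruthQuantaleProp : TruthQuantale Prop where
  tens p q := p ∧ q
  unit := True
  tens_comm _ _ := propext and_comm
  tens_assoc _ _ _ := propext and_assoc
  unit_tens _ := true_and _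
  tens_sSup a s := by
    apply propext
    simp only [sSup_Prop_eq, iSup_Prop_eq]
    constructor
    · rintro ⟨ha, p, hp, h⟩
      exact ⟨p, hp, ha, h⟩
    · rintro ⟨p, hp, ha, h⟩
      exact ⟨ha, p, hp, h⟩

/-- The quantale of distances: `[0, ∞]` with the reversed order and addition. -/
instance instTruthQuantaleDist : TruthQuantale ℝ≥0∞ᵒᵈ where
  tens a b := OrderDual.toDual (OrderDual.ofDual a + OrderDual.ofDual b)
  unit := OrderDual.toDual 0
  tens_comm _ _ := add_comm (G := ℝ≥0∞) _ _
  tens_assoc _ _ _ := add_assoc (G := ℝ≥0∞) _ _ _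
  unit_tens _ := zero_add (M := ℝ≥0∞) _
  tens_sSup a s := ENNReal.add_sInf (a := OrderDual.ofDual a) (s := s)

section Quantale

variable {V : Type} [CompleteLattice V] [TruthQuantale V]

/-- The residual `hom (x, -)`, right adjoint to `x ⊗ -`: implication for truth values, truncated
subtraction `y - x` for distances. -/
def qhom (x y : V) : V := sSup {z | tens x z ≤ y}

/-- The compact Hausdorff convergence `ξ` on `V`; for distances `ξ 𝔲 = sup_{A ∈ 𝔲} inf A`. -/
def xi (𝔲 : Ultrafilter V) : V := ⨅ A ∈ 𝔲, sSup A

/-! ### Ultrafilters, relations and spaces -/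

/-- The multiplication of the ultrafilter monad: `A ∈ ultraJoin 𝔛 ↔ {𝔵 | A ∈ 𝔵} ∈ 𝔛`. -/
def ultraJoin {X : Type u} (𝔛 : Ultrafilter (Ultrafilter X)) : Ultrafilter X :=
  Ultrafilter.bind 𝔛 id

/-- The extension of the ultrafilter functor to (numerical) relations. -/
def ultraExt {X Y : Type u} (r : X → Y → V) (𝔵 : Ultrafilter X) (𝔶 : Ultrafilter Y) : V :=
  ⨅ A ∈ 𝔵, ⨅ B ∈ 𝔶, ⨆ x ∈ A, ⨆ y ∈ B, r x y

/-- A set with a `V`-valued relation between ultrafilters and points. -/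
structure ConvSpace (V : Type) where
  carrier : Type u
  conv : Ultrafilter carrier → carrier → V

instance : CoeSort (ConvSpace.{u} V) (Type u) := ⟨ConvSpace.carrier⟩

/-- Continuous maps (`V = Prop`), respectively contractions (`V = ℝ≥0∞ᵒᵈ`). -/
def IsSpaceMap (X Y : ConvSpace.{u} V) (f : X → Y) : Prop :=
  ∀ (𝔵 : Ultrafilter X) (x : X), X.conv 𝔵 x ≤ Y.conv (𝔵.map f) (f x)

/-- `U`-relations `X ⇸ Y`, that is, (numerical) relations from `UX` to `Y`. -/
abbrev URel (X Y : ConvSpace.{u} V) : Type u := Ultrafilter X → Y → V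

/-- Kleisli composition `s ∘ r = s · Ur · m°` of `U`-relations `r : X ⇸ Y` and `s : Y ⇸ Z`. -/
def kleisli {X Y Z : ConvSpace.{u} V} (s : URel Y Z) (r : URel X Y) : URel X Z := fun 𝔵 z =>
  ⨆ (𝔛 : Ultrafilter (Ultrafilter X)) (_ : ultraJoin 𝔛 = 𝔵) (𝔶 : Ultrafilter Y),
    tens (ultraExt r 𝔛 𝔶) (s 𝔶 z)

/-- The one-point space `1`. -/
abbrev onePoint (V : Type) [CompleteLattice V] [TruthQuantale V] : ConvSpace.{u} V where
  carrier := PUnit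
  conv _ _ := unit

/-- The order, respectively metric, `Ua · m°` on `UX` induced by a space `(X, a)`. -/
def ultraHom (X : ConvSpace.{u} V) (𝔵 𝔶 : Ultrafilter X) : V :=
  ⨆ (𝔛 : Ultrafilter (Ultrafilter X)) (_ : ultraJoin 𝔛 = 𝔵), ultraExt X.conv 𝔛 𝔶

/-- The dual space of `X`: the set `UX` where the convergence of `𝔛` to `𝔵` is measured by the
order, respectively metric, of `UX` from `𝔵` to `ultraJoin 𝔛`. -/
abbrev dualSpace (X : ConvSpace.{u} V) : ConvSpace.{u} V where
  carrier := Ultrafilter X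
  conv 𝔛 𝔵 := ultraHom X 𝔵 (ultraJoin 𝔛)

/-- The product space (`V = Prop`), respectively the `+`-product of approach spaces
(`V = ℝ≥0∞ᵒᵈ`). -/
abbrev tensorSpace (X Y : ConvSpace.{u} V) : ConvSpace.{u} V where
  carrier := X × Y
  conv 𝔴 p := tens (X.conv (𝔴.map Prod.fst) p.1) (Y.conv (𝔴.map Prod.snd) p.2)

/-- The convergence on `V` itself: for `Prop` the Sierpiński space with `{True}` closed, for
distances the approach structure `(𝔲, v) ↦ v - ξ 𝔲` on `[0, ∞]`. -/
def valueConv (𝔲 : Ultrafilter V) (v : V) : V := qhom (xi 𝔲) v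

/-- A `U`-relation `φ : X ⇸ Y` is a `U`-module if it is continuous, respectively contractive, as a
map from the tensor product of the dual of `X` and `Y` to `V`. -/
def IsUModule {X Y : ConvSpace.{u} V} (φ : URel X Y) : Prop :=
  ∀ (𝔴 : Ultrafilter (tensorSpace (dualSpace X) Y)) (p : tensorSpace (dualSpace X) Y),
    (tensorSpace (dualSpace X) Y).conv 𝔴 p
      ≤ valueConv (𝔴.map fun q : Ultrafilter X × Y => φ q.1 q.2) (φ p.1 p.2)

/-- The module `f_* : X ⇸ Y`. -/
def lowerStar {X Y : ConvSpace.{u} V} (f : X → Y) : URel X Y := fun 𝔵 y => Y.conv (𝔵.map f) y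

/-- The module `f^* : Y ⇸ X`. -/
def upperStar {X Y : ConvSpace.{u} V} (f : X → Y) : URel Y X := fun 𝔶 x => Y.conv 𝔶 (f x)

/-- A point of `X` as a map `1 → X`. -/
abbrev pointMap {X : ConvSpace.{u} V} (x : X) : onePoint.{u} V → X := fun _ => x

/-- The presheaf space `PX`: the set of `U`-modules `X ⇸ 1` with the convergence of the function
space `V ^ (dual of X)`. -/
abbrev presheafSpace (X : ConvSpace.{u} V) : ConvSpace.{u} V where
  carrier := {ψ : URel X (onePoint.{u} V) // IsUModule ψ}
  conv 𝔭 h :=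
    ⨅ (𝔴 : Ultrafilter ({ψ : URel X (onePoint.{u} V) // IsUModule ψ} × Ultrafilter X))
      (_ : 𝔴.map Prod.fst = 𝔭) (𝔵 : Ultrafilter X),
      qhom ((dualSpace X).conv (𝔴.map Prod.snd) 𝔵)
        (valueConv (𝔴.map fun q => q.1.1 q.2 PUnit.unit) (h.1 𝔵 PUnit.unit))

/-- The subspace of `X` on a set of points. -/
abbrev subSpace (X : ConvSpace.{u} V) (s : Set X) : ConvSpace.{u} V where
  carrier := s
  conv 𝔵 x := X.conv (𝔵.map Subtype.val) x.1

/-- `x` is a colimit of the diagram `d : D → X` weighted by `ψ : D ⇸ 1`: the module `x_* : 1 ⇸ X`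
is the extension of `d_*` along `ψ`, that is, the largest module `χ : 1 ⇸ X` with
`χ ∘ ψ ⊑ d_*`. -/
def IsWeightedColimit {D X : ConvSpace.{u} V} (d : D → X) (ψ : URel D (onePoint.{u} V)) (x : X) :
    Prop :=
  IsGreatest {χ : URel (onePoint.{u} V) X | IsUModule χ ∧ kleisli χ ψ ≤ lowerStar d}
    (lowerStar (pointMap x))

/-! ### Families of modules

`S` is the class of all spaces under consideration (topological spaces or approach spaces) and `c`
sends a space to its convergence relation. -/

/-- A family `Φ[X]` of `U`-modules `X ⇸ 1`, one for each space `X`, that contains the representable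
modules `x^*`. -/
structure ModuleFamily {S : Type (u + 1)} (c : S → ConvSpace.{u} V) where
  mem : ∀ X : S, Set (URel (c X) (onePoint.{u} V))
  isUModule : ∀ (X : S) (ψ : URel (c X) (onePoint.{u} V)), ψ ∈ mem X → IsUModule ψ
  representable : ∀ (X : S) (x : c X), upperStar (pointMap x) ∈ mem X

namespace ModuleFamily

variable {S : Type (u + 1)} {c : S → ConvSpace.{u} V}

/-- The class `Φ-Mod`: the modules `φ : X ⇸ Y` with `y^* ∘ φ ∈ Φ[X]` for all points `y`. -/
def InMod (Φ : ModuleFamily c) (X Y : S) (φ : URel (c X) (c Y)) : Prop :=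
  IsUModule φ ∧ ∀ y : c Y, kleisli (upperStar (pointMap y)) φ ∈ Φ.mem X

/-- `Φ[X]` as a subspace of `PX`. -/
abbrev space (Φ : ModuleFamily c) (X : S) : ConvSpace.{u} V :=
  subSpace (presheafSpace (c X)) {ψ | ψ.1 ∈ Φ.mem X}

/-- The inclusion map `Φ[X] → PX`. -/
def incl (Φ : ModuleFamily c) (X : S) : Φ.space X → presheafSpace (c X) := fun ψ => ψ.1

/-- For each space `X`, `Φ[X]` has all `Φ`-weighted colimits and the inclusion of `Φ[X]` into `PX`
preserves them; equivalently, `Φ[X]` is closed under `Φ`-weighted colimits in `PX`. -/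
def Saturated (Φ : ModuleFamily c) : Prop :=
  ∀ (X D : S) (d : c D → Φ.space X) (ψ : URel (c D) (onePoint.{u} V)),
    IsSpaceMap (c D) (Φ.space X) d → ψ ∈ Φ.mem D →
      (∃ χ, IsWeightedColimit d ψ χ) ∧
        ∀ χ, IsWeightedColimit d ψ χ → IsWeightedColimit (Φ.incl X ∘ d) ψ (Φ.incl X χ)

/-- `Φ-Mod` is a subcategory of the category of `U`-modules: it contains the identity modules, which
are the convergence relations, and it is closed under Kleisli composition. -/
def IsSubcategory (Φ : ModuleFamily c) : Prop :=
  (∀ X : S, Φ.InMod X X (c X).conv) ∧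
    ∀ (X Y Z : S) (φ : URel (c X) (c Y)) (ψ : URel (c Y) (c Z)),
      Φ.InMod X Y φ → Φ.InMod Y Z ψ → Φ.InMod X Z (kleisli ψ φ)

/-- `Φ` is stable under composition with `f^*` for all maps `f`, and with `g_*` for all `Φ`-dense
maps `g`. -/
def IsStable (Φ : ModuleFamily c) : Prop :=
  ∀ (X Y : S) (ψ : URel (c X) (onePoint.{u} V)), ψ ∈ Φ.mem X →
    (∀ f : c X → c Y, IsSpaceMap (c X) (c Y) f → kleisli ψ (upperStar f) ∈ Φ.mem Y) ∧
      ∀ g : c Y → c X, IsSpaceMap (c Y) (c X) g → Φ.InMod Y X (lowerStar g) →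
        kleisli ψ (lowerStar g) ∈ Φ.mem Y

end ModuleFamily

end Quantale

/-! ### Topological spaces and approach spaces -/

/-- The ultrafilter convergence of a topological space. -/
abbrev topConv (X : TopCat.{u}) : ConvSpace.{u} Prop where
  carrier := X
  conv 𝔵 x := (𝔵 : Filter X) ≤ nhds x

/-- For topological spaces, the maps considered are the continuous maps. -/
theorem isSpaceMap_topConv_iff (X Y : TopCat.{u}) (f : X → Y) :
    IsSpaceMap (topConv X) (topConv Y) f ↔ Continuous f := by
  rw [continuous_iff_ultrafilter]
  exact ⟨fun h x 𝔵 hx => h 𝔵 x hx, fun h 𝔵 x hx => h x 𝔵 hx⟩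

/-- Approach spaces `(X, a)`; in terms of numbers, the axioms are `0 ≥ a(ẋ, x)` and
`Ua(𝔛, 𝔵) + a(𝔵, x) ≥ a(m 𝔛, x)`. -/
structure ApproachSpace extends ConvSpace.{u} ℝ≥0∞ᵒᵈ where
  conv_pure : ∀ x : carrier, unit ≤ conv (pure x) x
  conv_join : ∀ (𝔛 : Ultrafilter (Ultrafilter carrier)) (𝔵 : Ultrafilter carrier) (x : carrier),
    tens (ultraExt conv 𝔛 𝔵) (conv 𝔵 x) ≤ conv (ultraJoin 𝔛) x

/-- The numerical convergence of an approach space. -/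
abbrev appConv (X : ApproachSpace.{u}) : ConvSpace.{u} ℝ≥0∞ᵒᵈ := X.toConvSpace

/-! ### Quantale inequalities and complete distributivity. -/

namespace TruthQuantale

/-! Each of the three assertions is equivalent to one condition, `IsClosedUnderMod`: if `φ : X ⇸ Y`
lies in Mod(Φ) and `ψ` in Φ[Y], then `ψ ∘ φ` lies in Φ[X].

Saturation: a map `d : D → Φ[X]` is the transpose of a module `X ⇸ D` in Mod(Φ)
(`IsEvaluation.isSpaceMap_iff`), and composing `ψ` with that module gives the `ψ`-weighted colimit
of `d`, in PX as well as in any subspace that contains the composite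
(`IsEvaluation.isWeightedColimit`). Subcategory: the elements of Φ[Y] are the morphisms `Y ⇸ 1` of
Mod(Φ), and composition can be checked pointwise in the codomain. Stability: inside the collage of
`φ`, with inclusions `i` and `j`, one has `φ = j^* ∘ i_*` with `i_*` in Mod(Φ), so `ψ ∘ φ = (ψ ∘
j^*) ∘ i_*` uses only the two permitted operations.

Underneath lies the calculus of modules. `kleisliExt` gives `Ur · m°` by an explicit formula;
`kleisliExt_kleisli` shows that it turns Kleisli composition into relational composition, whence
associativity. Complete distributivity supplies ultrafilters on pairs as witnesses, and preservation
of nonempty infima lets `ξ` split a tensor. Both cases of the theorem then follow, since topological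
and approach spaces are exactly the reflexive, transitive convergence relations. -/

/-- Integral quantales that are completely distributive as lattices and whose tensor preserves
nonempty infima. -/
class IsContinuous (V : Type) [CompleteLattice V] [TruthQuantale V] : Prop where
  unit_eq_top : (unit : V) = ⊤
  iInf_tens_le : ∀ (a : V) (s : Set V), s.Nonempty → ⨅ b ∈ s, tens a b ≤ tens a (sInf s)
  le_sSup_totallyBelow : ∀ v : V, v ≤ sSup {w | ∀ s : Set V, v ≤ sSup s → ∃ b ∈ s, w ≤ b}

instance : IsContinuous Prop where
  unit_eq_top := rfl
  iInf_tens_le a s := by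
    rintro ⟨b, hb⟩ h
    simp only [iInf_Prop_eq] at h
    exact ⟨(h b hb).1, sInf_Prop_eq ▸ fun c hc => (h c hc).2⟩
  le_sSup_totallyBelow v hv := by
    rw [sSup_Prop_eq]
    refine ⟨True, fun s hs => ?_, trivial⟩
    have h := hs hv
    rw [sSup_Prop_eq] at h
    obtain ⟨b, hb, hb'⟩ := h
    exact ⟨b, hb, fun _ => hb'⟩

/-- Every number strictly greater than `v` is totally below `v` in the reversed order, and these
numbers have infimum `v`. -/
instance : IsContinuous ℝ≥0∞ᵒᵈ where
  unit_eq_top := rfl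
  iInf_tens_le a s hs := by
    have h : (OrderDual.ofDual a + sSup (OrderDual.toDual ⁻¹' s) : ℝ≥0∞)
        ≤ ⨆ b ∈ (OrderDual.toDual ⁻¹' s), (OrderDual.ofDual a + b) :=
      (ENNReal.add_sSup (s := OrderDual.toDual ⁻¹' s) hs).le
    exact h
  le_sSup_totallyBelow v := by
    change sInf {w : ℝ≥0∞ | ∀ s : Set ℝ≥0∞, sInf s ≤ OrderDual.ofDual v → ∃ b ∈ s, b ≤ w}
      ≤ OrderDual.ofDual v
    refine le_of_forall_gt_imp_ge_of_dense fun w hw => sInf_le fun s hs => ?_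
    obtain ⟨b, hb, h⟩ := sInf_lt_iff.1 (hs.trans_lt hw)
    exact ⟨b, hb, h.le⟩

variable {V : Type} [CompleteLattice V]

/-- `w` is totally below `v`. -/
def TotallyBelow (w v : V) : Prop := ∀ s : Set V, v ≤ sSup s → ∃ b ∈ s, w ≤ b

variable [TruthQuantale V]

/-- Complete distributivity enters the arguments here: each test value `w` lies below a single
member of any family whose join dominates `v`, so joins can be replaced by witnesses. -/
theorem le_of_forall_totallyBelow [IsContinuous V] {v x : V}
    (h : ∀ w, TotallyBelow w v → w ≤ x) : v ≤ x :=
  (IsContinuous.le_sSup_totallyBelow v).trans (sSup_le h)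

theorem tens_mono_right (a : V) {b c : V} (h : b ≤ c) : tens a b ≤ tens a c := by
  have : c = sSup {b, c} := by rw [sSup_pair, sup_eq_right.2 h]
  rw [this, tens_sSup]
  exact le_iSup₂_of_le b (by simp) le_rfl

theorem tens_mono {a b c d : V} (h : a ≤ b) (h' : c ≤ d) : tens a c ≤ tens b d := by
  refine (tens_mono_right a h').trans ?_
  rw [tens_comm a, tens_comm b]
  exact tens_mono_right d h

theorem tens_iSup {ι : Sort*} (a : V) (f : ι → V) : tens a (⨆ i, f i) = ⨆ i, tens a (f i) := by
  rw [iSup, tens_sSup, iSup_range]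

theorem iSup_tens {ι : Sort*} (f : ι → V) (a : V) : tens (⨆ i, f i) a = ⨆ i, tens (f i) a := by
  simp only [tens_comm _ a, tens_iSup]

theorem tens_unit (a : V) : tens a unit = a := by rw [tens_comm, unit_tens]

theorem tens_bot (a : V) : tens a ⊥ = ⊥ := by simpa using tens_sSup a (∅ : Set V)

theorem bot_tens (a : V) : tens ⊥ a = ⊥ := by rw [tens_comm, tens_bot]

theorem le_qhom_iff {x y v : V} : v ≤ qhom x y ↔ tens x v ≤ y := by
  refine ⟨fun h => (tens_mono_right x h).trans ?_, fun h => le_sSup h⟩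
  rw [qhom, tens_sSup]
  exact iSup₂_le fun _ hz => hz

theorem le_tens_sInf [IsContinuous V] {s t : Set V} (hs : s.Nonempty) (ht : t.Nonempty)
    {v : V} (h : ∀ a ∈ s, ∀ b ∈ t, v ≤ tens a b) : v ≤ tens (sInf s) (sInf t) := by
  refine le_trans (le_iInf₂ fun b hb => ?_) (IsContinuous.iInf_tens_le _ _ ht)
  rw [tens_comm]
  refine le_trans (le_iInf₂ fun a ha => ?_) (IsContinuous.iInf_tens_le _ _ hs)
  rw [tens_comm]
  exact h a ha b hb

end TruthQuantale

/-! ### Ultrafilter extension of relations and the algebra of Kleisli composition. -/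

section Extension

variable {V : Type} [CompleteLattice V]

theorem xi_map_le {W : Type*} {𝔴 : Ultrafilter W} {f : W → V} {s : Set W} (hs : s ∈ 𝔴) :
    xi (𝔴.map f) ≤ sSup (f '' s) :=
  iInf₂_le _ (Filter.image_mem_map hs)

theorem xi_map_le_of_forall_le {W : Type*} {𝔴 : Ultrafilter W} {f : W → V} {s : Set W} {v : V}
    (hs : s ∈ 𝔴) (h : ∀ w ∈ s, f w ≤ v) : xi (𝔴.map f) ≤ v :=
  (xi_map_le hs).trans (sSup_le (by rintro _ ⟨w, hw, rfl⟩; exact h w hw))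

theorem le_xi_map {W : Type*} {𝔴 : Ultrafilter W} {f : W → V} {v : V}
    (h : {w | v ≤ f w} ∈ 𝔴) : v ≤ xi (𝔴.map f) := by
  refine le_iInf₂ fun A hA => ?_
  obtain ⟨w, hw, hw'⟩ := 𝔴.nonempty_of_mem (Filter.inter_mem h hA)
  exact le_trans (b := f w) hw (le_sSup hw')

variable {X Y Z : Type u}

theorem mem_ultraJoin {𝔛 : Ultrafilter (Ultrafilter X)} {A : Set X} :
    A ∈ ultraJoin 𝔛 ↔ {𝔵 : Ultrafilter X | A ∈ 𝔵} ∈ 𝔛 := Iff.rfl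

/-- The extension `Ur · m°` of a `U`-relation to a relation between ultrafilters. -/
def kleisliExt (r : Ultrafilter X → Y → V) (𝔵 : Ultrafilter X) (𝔶 : Ultrafilter Y) : V :=
  ⨅ A ∈ 𝔵, ⨅ B ∈ 𝔶, sSup ((fun p : Ultrafilter X × Y => r p.1 p.2) '' {p | A ∈ p.1 ∧ p.2 ∈ B})

theorem le_kleisliExt {r : Ultrafilter X → Y → V} {𝔵 : Ultrafilter X} {𝔶 : Ultrafilter Y} {v : V}
    (h : ∀ A ∈ 𝔵, ∀ B ∈ 𝔶, v ≤ sSup ((fun p : Ultrafilter X × Y => r p.1 p.2) ''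
      {p | A ∈ p.1 ∧ p.2 ∈ B})) : v ≤ kleisliExt r 𝔵 𝔶 :=
  le_iInf₂ fun A hA => le_iInf₂ fun B hB => h A hA B hB

theorem kleisliExt_le {r : Ultrafilter X → Y → V} {𝔵 : Ultrafilter X} {𝔶 : Ultrafilter Y}
    {A : Set X} {B : Set Y} (hA : A ∈ 𝔵) (hB : B ∈ 𝔶) :
    kleisliExt r 𝔵 𝔶
      ≤ sSup ((fun p : Ultrafilter X × Y => r p.1 p.2) '' {p | A ∈ p.1 ∧ p.2 ∈ B}) :=
  (iInf₂_le A hA).trans (iInf₂_le B hB)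

theorem kleisliExt_mono {r s : Ultrafilter X → Y → V} (h : r ≤ s) (𝔵 : Ultrafilter X)
    (𝔶 : Ultrafilter Y) : kleisliExt r 𝔵 𝔶 ≤ kleisliExt s 𝔵 𝔶 := by
  refine le_kleisliExt fun A hA B hB => (kleisliExt_le hA hB).trans (sSup_le ?_)
  rintro _ ⟨p, hp, rfl⟩
  exact (h p.1 p.2).trans (le_sSup ⟨p, hp, rfl⟩)

/-- The hypothesis is the finite intersection property for the preimages of the basic sets `{𝔵' | A
∈ 𝔵'}` and `B`, taken inside `S`. Any ultrafilter refining the resulting filter has the prescribed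
join and projection. -/
theorem exists_ultrafilter_of_forall {W : Type u} {p : W → Ultrafilter X} {q : W → Y}
    {S : Set W} {𝔵 : Ultrafilter X} {𝔶 : Ultrafilter Y}
    (h : ∀ A ∈ 𝔵, ∀ B ∈ 𝔶, ∃ w ∈ S, A ∈ p w ∧ q w ∈ B) :
    ∃ 𝔴 : Ultrafilter W, S ∈ 𝔴 ∧ ultraJoin (𝔴.map p) = 𝔵 ∧ 𝔴.map q = 𝔶 := by
  let F : Filter W := (Filter.comap p ((𝔵 : Filter X).lift' fun A => {𝔵' | A ∈ 𝔵'})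
    ⊓ Filter.comap q 𝔶) ⊓ Filter.principal S
  have hmono : Monotone fun A : Set X => {𝔵' : Ultrafilter X | A ∈ 𝔵'} :=
    fun A B hAB 𝔵' h => Filter.mem_of_superset h hAB
  have hF : F.NeBot := by
    rw [Filter.inf_principal_neBot_iff]
    intro U hU
    obtain ⟨U₁, ⟨T, hT, hT'⟩, U₂, ⟨B, hB, hB'⟩, rfl⟩ := Filter.mem_inf_iff.1 hU
    obtain ⟨A, hA, hAT⟩ := (Filter.mem_lift'_sets hmono).1 hT
    obtain ⟨w, hwS, hwA, hwB⟩ := h A hA B hB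
    exact ⟨w, ⟨hT' (hAT hwA), hB' hwB⟩, hwS⟩
  refine ⟨Ultrafilter.of F, Ultrafilter.of_le F (Filter.mem_inf_of_right (by simp)), ?_, ?_⟩
  · refine Ultrafilter.eq_of_le fun A hA => ?_
    exact Ultrafilter.of_le F (Filter.mem_inf_of_left (Filter.mem_inf_of_left
      (Filter.preimage_mem_comap (Filter.mem_lift' hA))))
  · refine Ultrafilter.eq_of_le fun B hB => ?_
    exact Ultrafilter.of_le F (Filter.mem_inf_of_left (Filter.mem_inf_of_right
      (Filter.preimage_mem_comap hB)))

theorem xi_map_le_ultraExt {W : Type u} (r : X → Y → V) (p : W → X) (q : W → Y)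
    (𝔴 : Ultrafilter W) :
    xi (𝔴.map fun w => r (p w) (q w)) ≤ ultraExt r (𝔴.map p) (𝔴.map q) := by
  refine le_iInf₂ fun A hA => le_iInf₂ fun B hB => ?_
  refine xi_map_le_of_forall_le (Filter.inter_mem hA hB) fun w hw => ?_
  exact le_iSup₂_of_le (p w) hw.1 (le_iSup₂_of_le (q w) hw.2 le_rfl)

theorem ultraExt_le_kleisliExt (r : Ultrafilter X → Y → V) (𝔛 : Ultrafilter (Ultrafilter X))
    (𝔶 : Ultrafilter Y) : ultraExt r 𝔛 𝔶 ≤ kleisliExt r (ultraJoin 𝔛) 𝔶 := by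
  refine le_kleisliExt fun A hA B hB => ?_
  refine (iInf₂_le _ (mem_ultraJoin.1 hA)).trans ((iInf₂_le B hB).trans ?_)
  exact iSup₂_le fun 𝔵 h𝔵 => iSup₂_le fun y hy => le_sSup ⟨(𝔵, y), ⟨h𝔵, hy⟩, rfl⟩

theorem xi_map_le_kleisliExt {W : Type u} (r : Ultrafilter X → Y → V) (p : W → Ultrafilter X)
    (q : W → Y) (𝔴 : Ultrafilter W) :
    xi (𝔴.map fun w => r (p w) (q w)) ≤ kleisliExt r (ultraJoin (𝔴.map p)) (𝔴.map q) :=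
  (xi_map_le_ultraExt r p q 𝔴).trans (ultraExt_le_kleisliExt r _ _)

/-- Each supremum in the formula for `kleisliExt` dominates its value, so for all `A` and `B` some
pair is related to degree at least `v`. An ultrafilter can therefore be concentrated on such pairs.
-/
theorem exists_le_xi_map {r : Ultrafilter X → Y → V} {𝔵 : Ultrafilter X} {𝔶 : Ultrafilter Y}
    {v : V} (hv : TotallyBelow v (kleisliExt r 𝔵 𝔶)) :
    ∃ 𝔴 : Ultrafilter (Ultrafilter X × Y), ultraJoin (𝔴.map Prod.fst) = 𝔵 ∧
      𝔴.map Prod.snd = 𝔶 ∧ v ≤ xi (𝔴.map fun p => r p.1 p.2) := by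
  obtain ⟨𝔴, hS, h₁, h₂⟩ := exists_ultrafilter_of_forall
    (p := fun p : Ultrafilter X × Y => p.1) (q := fun p => p.2)
    (S := {p : Ultrafilter X × Y | v ≤ r p.1 p.2}) (𝔵 := 𝔵) (𝔶 := 𝔶)
    (fun A hA B hB => by
      obtain ⟨_, ⟨p, hp, rfl⟩, hvp⟩ := hv _ (kleisliExt_le hA hB)
      exact ⟨p, hvp, hp⟩)
  exact ⟨𝔴, h₁, h₂, le_xi_map hS⟩

theorem le_kleisliExt_pure (r : Ultrafilter X → Y → V) (𝔵 : Ultrafilter X) (y : Y) :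
    r 𝔵 y ≤ kleisliExt r 𝔵 (pure y) :=
  le_kleisliExt fun _ hA _ hB => le_sSup ⟨(𝔵, y), ⟨hA, hB⟩, rfl⟩

/-- Pairs witnessing the hypothesis carry an ultrafilter lying over `𝔶`; the join of its first
projection is the required `𝔵`. For a topological convergence this is the step from limits of limits
to limits. -/
theorem exists_le_kleisliExt {r : Ultrafilter X → Y → V} {𝔶 : Ultrafilter Y} {v : V} {A : Set X}
    (h : {y | ∃ 𝔵 : Ultrafilter X, A ∈ 𝔵 ∧ v ≤ r 𝔵 y} ∈ 𝔶) :
    ∃ 𝔵 : Ultrafilter X, A ∈ 𝔵 ∧ v ≤ kleisliExt r 𝔵 𝔶 := by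
  let F : Filter (Ultrafilter X × Y) := Filter.comap Prod.snd 𝔶
    ⊓ Filter.principal {p | A ∈ p.1 ∧ v ≤ r p.1 p.2}
  have hF : F.NeBot := by
    rw [Filter.inf_principal_neBot_iff]
    rintro U ⟨B, hB, hBU⟩
    obtain ⟨y, ⟨𝔵, h₁, h₂⟩, hy⟩ := 𝔶.nonempty_of_mem (Filter.inter_mem h hB)
    exact ⟨(𝔵, y), hBU hy, h₁, h₂⟩
  have hS : {p : Ultrafilter X × Y | A ∈ p.1 ∧ v ≤ r p.1 p.2} ∈ Ultrafilter.of F :=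
    Ultrafilter.of_le F (Filter.mem_inf_of_right (by simp))
  have h𝔶 : (Ultrafilter.of F).map Prod.snd = 𝔶 := Ultrafilter.eq_of_le fun B hB =>
    Ultrafilter.of_le F (Filter.mem_inf_of_left (Filter.preimage_mem_comap hB))
  refine ⟨ultraJoin ((Ultrafilter.of F).map Prod.fst),
    show {p | A ∈ p.1} ∈ Ultrafilter.of F from Filter.mem_of_superset hS fun p hp => hp.1, ?_⟩
  nth_rw 1 [← h𝔶]
  exact (le_xi_map (Filter.mem_of_superset hS fun p hp => hp.2)).trans
    (xi_map_le_kleisliExt r Prod.fst Prod.snd _)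

theorem exists_map_eq_of_image_mem {X X' : Type u} {i : X → X'} (hi : i.Injective)
    {A : Set X} {𝔵 : Ultrafilter X'} (h : i '' A ∈ 𝔵) :
    ∃ 𝔷 : Ultrafilter X, 𝔷.map i = 𝔵 ∧ A ∈ 𝔷 := by
  have hr : Set.range i ∈ 𝔵 := Filter.mem_of_superset h (Set.image_subset_range i A)
  refine ⟨𝔵.comap hi hr, Ultrafilter.coe_injective ?_, ?_⟩
  · rw [Ultrafilter.coe_map, Ultrafilter.coe_comap, Filter.map_comap_of_mem hr]
  · rw [← Ultrafilter.mem_coe, Ultrafilter.coe_comap, Filter.mem_comap]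
    exact ⟨_, h, (Set.preimage_image_eq A hi).subset⟩

/-- Injectivity of `i` ensures that every ultrafilter containing `i '' A` is the image of one on
`X`; nothing of the kind is needed for `j`. -/
theorem kleisliExt_map {X' Y' : Type u} {i : X → X'} (hi : i.Injective) (j : Y → Y')
    (r : Ultrafilter X' → Y' → V) (𝔵 : Ultrafilter X) (𝔶 : Ultrafilter Y) :
    kleisliExt r (𝔵.map i) (𝔶.map j) = kleisliExt (fun 𝔵 y => r (𝔵.map i) (j y)) 𝔵 𝔶 := by
  refine le_antisymm (le_kleisliExt fun A hA B hB => ?_) (le_kleisliExt fun A hA B hB => ?_)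
  · refine (kleisliExt_le (A := i '' A) (B := j '' B) (Filter.image_mem_map hA)
      (Filter.image_mem_map hB)).trans (sSup_le ?_)
    rintro _ ⟨⟨𝔷, _⟩, ⟨h𝔷, y, hy, rfl⟩, rfl⟩
    obtain ⟨𝔷, rfl, hA'⟩ := exists_map_eq_of_image_mem hi h𝔷
    exact le_sSup ⟨(𝔷, y), ⟨hA', hy⟩, rfl⟩
  · refine (kleisliExt_le (A := i ⁻¹' A) (B := j ⁻¹' B) hA hB).trans (sSup_le ?_)
    rintro _ ⟨⟨𝔷, y⟩, ⟨h𝔷, hy⟩, rfl⟩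
    exact le_sSup ⟨(𝔷.map i, j y), ⟨h𝔷, hy⟩, rfl⟩

theorem kleisliExt_map_right {X Y Y' : Type u} (r : Ultrafilter X → Y' → V) (j : Y → Y')
    (𝔵 : Ultrafilter X) (𝔶 : Ultrafilter Y) :
    kleisliExt r 𝔵 (𝔶.map j) = kleisliExt (fun 𝔵 y => r 𝔵 (j y)) 𝔵 𝔶 := by
  have h := kleisliExt_map Function.injective_id j r 𝔵 𝔶
  simpa only [Ultrafilter.map_id] using h

variable [TruthQuantale V] [IsContinuous V]

/-- The map `ξ` is compatible with the tensor. -/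
theorem le_tens_xi_map {W : Type*} {𝔴 : Ultrafilter W} {f g : W → V} {v : V}
    (h : {w | v ≤ tens (f w) (g w)} ∈ 𝔴) : v ≤ tens (xi (𝔴.map f)) (xi (𝔴.map g)) := by
  -- As an infimum of a nonempty set, `ξ` falls under `le_tens_sInf`.
  have key : ∀ 𝔲 : Ultrafilter V, xi 𝔲 = sInf (sSup '' {A | A ∈ 𝔲}) := by
    intro 𝔲
    rw [sInf_image]
    rfl
  have hne : ∀ 𝔲 : Ultrafilter V, (sSup '' {A | A ∈ 𝔲}).Nonempty := fun 𝔲 =>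
    ⟨_, _, (Filter.univ_mem : _ ∈ (𝔲 : Filter V)), rfl⟩
  rw [key, key]
  refine le_tens_sInf (hne _) (hne _) ?_
  rintro _ ⟨A, hA, rfl⟩ _ ⟨B, hB, rfl⟩
  obtain ⟨w, hw, hwA, hwB⟩ := 𝔴.nonempty_of_mem (Filter.inter_mem h (Filter.inter_mem hA hB))
  exact le_trans (b := tens (f w) (g w)) hw (tens_mono (le_sSup hwA) (le_sSup hwB))

theorem kleisliExt_eq_iSup_ultraExt (r : Ultrafilter X → Y → V) (𝔵 : Ultrafilter X)
    (𝔶 : Ultrafilter Y) : kleisliExt r 𝔵 𝔶 =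
      ⨆ (𝔛 : Ultrafilter (Ultrafilter X)) (_ : ultraJoin 𝔛 = 𝔵), ultraExt r 𝔛 𝔶 := by
  refine le_antisymm (le_of_forall_totallyBelow fun v hv => ?_) (iSup₂_le ?_)
  · obtain ⟨𝔴, h₁, rfl, h⟩ := exists_le_xi_map hv
    exact le_iSup₂_of_le _ h₁ (h.trans (xi_map_le_ultraExt r Prod.fst Prod.snd 𝔴))
  · rintro 𝔛 rfl
    exact ultraExt_le_kleisliExt r 𝔛 𝔶

/-- Modules and function spaces are defined by ultrafilters on pairs; this translates such
conditions into `kleisliExt`. -/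
theorem kleisliExt_tens_le_iff {r : Ultrafilter X → Y → V} {𝔵 : Ultrafilter X}
    {𝔶 : Ultrafilter Y} {v x : V} : tens (kleisliExt r 𝔵 𝔶) v ≤ x ↔
      ∀ 𝔴 : Ultrafilter (Ultrafilter X × Y), ultraJoin (𝔴.map Prod.fst) = 𝔵 →
        𝔴.map Prod.snd = 𝔶 → tens (xi (𝔴.map fun p => r p.1 p.2)) v ≤ x := by
  constructor
  · rintro h 𝔴 rfl rfl
    exact (tens_mono (xi_map_le_kleisliExt r Prod.fst Prod.snd 𝔴) le_rfl).trans h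
  · intro h
    rw [tens_comm, ← le_qhom_iff]
    refine le_of_forall_totallyBelow fun w hw => ?_
    obtain ⟨𝔴, h₁, h₂, h'⟩ := exists_le_xi_map hw
    rw [le_qhom_iff, tens_comm]
    exact (tens_mono h' le_rfl).trans (h 𝔴 h₁ h₂)

theorem ultraHom_eq (X : ConvSpace.{u} V) : ultraHom X = kleisliExt X.conv := by
  funext 𝔵 𝔶
  exact (kleisliExt_eq_iSup_ultraExt X.conv 𝔵 𝔶).symm

theorem kleisli_apply {X Y Z : ConvSpace.{u} V} (s : URel Y Z) (r : URel X Y) (𝔵 : Ultrafilter X)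
    (z : Z) : kleisli s r 𝔵 z = ⨆ 𝔶, tens (kleisliExt r 𝔵 𝔶) (s 𝔶 z) := by
  simp only [kleisli, kleisliExt_eq_iSup_ultraExt, iSup_tens]
  refine le_antisymm (iSup₂_le fun 𝔛 h => iSup_le fun 𝔶 => ?_)
    (iSup_le fun 𝔶 => iSup₂_le fun 𝔛 h => ?_)
  · exact le_iSup_of_le 𝔶 (le_iSup₂_of_le 𝔛 h le_rfl)
  · exact le_iSup₂_of_le 𝔛 h (le_iSup_of_le 𝔶 le_rfl)

theorem tens_kleisliExt_le {X Y Z : ConvSpace.{u} V} (s : URel Y Z) (r : URel X Y)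
    (𝔵 : Ultrafilter X) (𝔶 : Ultrafilter Y) (𝔷 : Ultrafilter Z) :
    tens (kleisliExt r 𝔵 𝔶) (kleisliExt s 𝔶 𝔷) ≤ kleisliExt (kleisli s r) 𝔵 𝔷 := by
  rw [tens_comm, ← le_qhom_iff]
  refine le_of_forall_totallyBelow fun v hv => ?_
  rw [le_qhom_iff, tens_comm, ← le_qhom_iff]
  refine le_of_forall_totallyBelow fun w hw => ?_
  rw [le_qhom_iff]
  refine le_kleisliExt fun A hA C hC => ?_
  -- If this set were not in `𝔶`, its complement would be, and `v` being totally below would produce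
  -- a related pair in that complement.
  have hB : {y | ∃ 𝔵 : Ultrafilter X, A ∈ 𝔵 ∧ v ≤ r 𝔵 y} ∈ 𝔶 := by
    by_contra hB
    obtain ⟨_, ⟨p, hp, rfl⟩, hvp⟩ := hv _ (kleisliExt_le hA (Ultrafilter.compl_mem_iff_notMem.2 hB))
    exact hp.2 ⟨p.1, hp.1, hvp⟩
  obtain ⟨_, ⟨⟨𝔶', z⟩, ⟨h𝔶', hz⟩, rfl⟩, hw'⟩ := hw _ (kleisliExt_le hB hC)
  obtain ⟨𝔵', h𝔵', hv'⟩ := exists_le_kleisliExt h𝔶'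
  refine le_trans ?_ (le_sSup ⟨(𝔵', z), ⟨h𝔵', hz⟩, rfl⟩)
  exact (le_iSup_of_le 𝔶' (tens_mono hv' hw')).trans (kleisli_apply s r 𝔵' z).ge

/-- For the nontrivial inequality, an ultrafilter is concentrated on triples `(𝔵', 𝔶', z)` of value
at least `v`. The join of its middle projection is the intermediate ultrafilter, and
`le_tens_xi_map` separates the two factors. -/
theorem kleisliExt_kleisli {X Y Z : ConvSpace.{u} V} (s : URel Y Z) (r : URel X Y)
    (𝔵 : Ultrafilter X) (𝔷 : Ultrafilter Z) : kleisliExt (kleisli s r) 𝔵 𝔷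
      = ⨆ 𝔶, tens (kleisliExt r 𝔵 𝔶) (kleisliExt s 𝔶 𝔷) := by
  refine le_antisymm (le_of_forall_totallyBelow fun v hv => ?_)
    (iSup_le fun 𝔶 => tens_kleisliExt_le s r 𝔵 𝔶 𝔷)
  have key : ∀ A ∈ 𝔵, ∀ C ∈ 𝔷, kleisliExt (kleisli s r) 𝔵 𝔷
      ≤ sSup ((fun w : Ultrafilter X × Ultrafilter Y × Z =>
        tens (kleisliExt r w.1 w.2.1) (s w.2.1 w.2.2)) '' {w | A ∈ w.1 ∧ w.2.2 ∈ C}) := by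
    intro A hA C hC
    refine (kleisliExt_le hA hC).trans (sSup_le ?_)
    rintro _ ⟨⟨𝔵', z⟩, h, rfl⟩
    exact (kleisli_apply s r 𝔵' z).le.trans (iSup_le fun 𝔶' => le_sSup ⟨(𝔵', 𝔶', z), h, rfl⟩)
  obtain ⟨𝔴, hS, rfl, rfl⟩ := exists_ultrafilter_of_forall
    (p := fun w : Ultrafilter X × Ultrafilter Y × Z => w.1) (q := fun w => w.2.2)
    (S := {w | v ≤ tens (kleisliExt r w.1 w.2.1) (s w.2.1 w.2.2)}) (𝔵 := 𝔵) (𝔶 := 𝔷)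
    (fun A hA C hC => by
      obtain ⟨_, ⟨w, h, rfl⟩, hv'⟩ := hv _ (key A hA C hC)
      exact ⟨w, hv', h⟩)
  have h : kleisliExt r (ultraJoin (𝔴.map fun w => w.1)) (ultraJoin (𝔴.map fun w => w.2.1))
      ≥ xi (𝔴.map fun w => kleisliExt r w.1 w.2.1) := by
    refine le_kleisliExt fun A hA B hB => ?_
    exact xi_map_le_of_forall_le (Filter.inter_mem hA hB) fun w hw => kleisliExt_le hw.1 hw.2
  have h' := xi_map_le_kleisliExt s (fun w : Ultrafilter X × Ultrafilter Y × Z => w.2.1)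
    (fun w => w.2.2) 𝔴
  exact le_iSup_of_le _ ((le_tens_xi_map hS).trans (tens_mono h h'))

theorem kleisli_assoc {W X Y Z : ConvSpace.{u} V} (t : URel Y Z) (s : URel X Y) (r : URel W X) :
    kleisli (kleisli t s) r = kleisli t (kleisli s r) := by
  funext 𝔴 z
  simp only [kleisli_apply, kleisliExt_kleisli, iSup_tens, tens_iSup, tens_assoc]
  exact iSup_comm

theorem kleisli_mono {X Y Z : ConvSpace.{u} V} {s s' : URel Y Z} {r r' : URel X Y} (hs : s ≤ s')
    (hr : r ≤ r') : kleisli s r ≤ kleisli s' r' := by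
  intro 𝔵 z
  simp only [kleisli_apply]
  exact iSup_mono fun 𝔶 => tens_mono (kleisliExt_mono hr _ _) (hs _ _)

end Extension

/-! ### Reflexive transitive convergence and modules as two-sided actions. -/

section Spaces

variable {V : Type} [CompleteLattice V]

theorem kleisliExt_conv_le_map {X Y : ConvSpace.{u} V} {f : X → Y}
    (hf : IsSpaceMap X Y f) (𝔵 𝔵' : Ultrafilter X) :
    kleisliExt X.conv 𝔵 𝔵' ≤ kleisliExt Y.conv (𝔵.map f) (𝔵'.map f) := by
  refine le_kleisliExt fun A hA B hB => ?_
  refine (kleisliExt_le (A := f ⁻¹' A) (B := f ⁻¹' B) hA hB).trans (sSup_le ?_)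
  rintro _ ⟨⟨𝔷, x⟩, ⟨h𝔷, hx⟩, rfl⟩
  exact (hf 𝔷 x).trans (le_sSup ⟨(𝔷.map f, f x), ⟨h𝔷, hx⟩, rfl⟩)

variable [TruthQuantale V]

/-- The axioms of a space: reflexivity and transitivity of the convergence relation. -/
structure IsSpace (X : ConvSpace.{u} V) : Prop where
  conv_pure : ∀ x : X, unit ≤ X.conv (pure x) x
  conv_trans : ∀ (𝔵 𝔶 : Ultrafilter X) (x : X),
    tens (kleisliExt X.conv 𝔵 𝔶) (X.conv 𝔶 x) ≤ X.conv 𝔵 x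

theorem IsSpace.unit_le_kleisliExt {X : ConvSpace.{u} V} (hX : IsSpace X) (𝔵 : Ultrafilter X) :
    unit ≤ kleisliExt X.conv 𝔵 𝔵 := by
  refine le_kleisliExt fun A hA B hB => ?_
  obtain ⟨x, hxA, hxB⟩ := 𝔵.nonempty_of_mem (Filter.inter_mem hA hB)
  exact (hX.conv_pure x).trans (le_sSup ⟨(pure x, x), ⟨hxA, hxB⟩, rfl⟩)

/-- A `U`-relation that is stable under composition with the convergence relations on both
sides. -/
structure IsBimodule {X Y : ConvSpace.{u} V} (φ : URel X Y) : Prop where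
  left : ∀ (𝔵 : Ultrafilter X) (𝔶 : Ultrafilter Y) (y : Y),
    tens (kleisliExt φ 𝔵 𝔶) (Y.conv 𝔶 y) ≤ φ 𝔵 y
  right : ∀ (𝔵 𝔵' : Ultrafilter X) (y : Y), tens (kleisliExt X.conv 𝔵 𝔵') (φ 𝔵' y) ≤ φ 𝔵 y

theorem IsSpace.isBimodule_conv {X : ConvSpace.{u} V} (hX : IsSpace X) : IsBimodule X.conv :=
  ⟨hX.conv_trans, hX.conv_trans⟩

/-- Every ultrafilter on the one-point space converges with value `unit`, so the left action gives
the upper bound. -/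
theorem IsBimodule.kleisliExt_onePoint {X : ConvSpace.{u} V} {ψ : URel X (onePoint.{u} V)}
    (hψ : IsBimodule ψ) (𝔵 : Ultrafilter X) (𝔶 : Ultrafilter (onePoint.{u} V)) :
    kleisliExt ψ 𝔵 𝔶 = ψ 𝔵 PUnit.unit := by
  refine le_antisymm ((tens_unit _).ge.trans (hψ.left 𝔵 𝔶 PUnit.unit)) ?_
  refine le_kleisliExt fun A hA B hB => ?_
  obtain ⟨y, hy⟩ := 𝔶.nonempty_of_mem hB
  exact le_sSup ⟨(𝔵, y), ⟨hA, hy⟩, rfl⟩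

theorem isBimodule_lowerStar {X Y : ConvSpace.{u} V} (hY : IsSpace Y) {f : X → Y}
    (hf : IsSpaceMap X Y f) : IsBimodule (lowerStar f) := by
  refine ⟨fun 𝔵 𝔶 y => le_trans (tens_mono ?_ le_rfl) (hY.conv_trans (𝔵.map f) 𝔶 y),
    fun 𝔵 𝔵' y => (tens_mono (kleisliExt_conv_le_map hf 𝔵 𝔵') le_rfl).trans
      (hY.conv_trans _ _ _)⟩
  refine le_kleisliExt fun A hA B hB => ?_
  refine (kleisliExt_le (A := f ⁻¹' A) hA hB).trans (sSup_le ?_)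
  rintro _ ⟨⟨𝔷, x⟩, ⟨h𝔷, hx⟩, rfl⟩
  exact le_sSup ⟨(𝔷.map f, x), ⟨h𝔷, hx⟩, rfl⟩

theorem isBimodule_upperStar {X Y : ConvSpace.{u} V} (hY : IsSpace Y) {f : X → Y}
    (hf : IsSpaceMap X Y f) : IsBimodule (upperStar f) := by
  refine ⟨fun 𝔶 𝔵 x => le_trans (tens_mono ?_ (hf 𝔵 x)) (hY.conv_trans 𝔶 (𝔵.map f) (f x)),
    fun 𝔶 𝔶' x => hY.conv_trans 𝔶 𝔶' (f x)⟩
  refine le_kleisliExt fun A hA B hB => ?_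
  refine (kleisliExt_le (B := f ⁻¹' B) hA hB).trans (sSup_le ?_)
  rintro _ ⟨⟨𝔷, x⟩, ⟨h𝔷, hx⟩, rfl⟩
  exact le_sSup ⟨(𝔷, f x), ⟨h𝔷, hx⟩, rfl⟩

variable [IsContinuous V]

theorem isSpace_iff {X : ConvSpace.{u} V} : IsSpace X ↔
    (∀ x : X, unit ≤ X.conv (pure x) x) ∧
      ∀ (𝔛 : Ultrafilter (Ultrafilter X)) (𝔵 : Ultrafilter X) (x : X),
        tens (ultraExt X.conv 𝔛 𝔵) (X.conv 𝔵 x) ≤ X.conv (ultraJoin 𝔛) x := by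
  refine ⟨fun h => ⟨h.1, fun 𝔛 𝔵 x => ?_⟩, fun h => ⟨h.1, fun 𝔵 𝔶 x => ?_⟩⟩
  · exact (tens_mono (ultraExt_le_kleisliExt _ _ _) le_rfl).trans (h.2 _ 𝔵 x)
  · rw [kleisliExt_eq_iSup_ultraExt, iSup_tens]
    refine iSup_le fun 𝔛 => ?_
    rw [iSup_tens]
    refine iSup_le fun h𝔛 => ?_
    subst h𝔛
    exact h.2 𝔛 𝔶 x

theorem isUModule_iff_kleisliExt {X Y : ConvSpace.{u} V} (φ : URel X Y) : IsUModule φ ↔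
    ∀ (𝔵 𝔵' : Ultrafilter X) (𝔶 : Ultrafilter Y) (y : Y),
      tens (kleisliExt φ 𝔵' 𝔶) (tens (kleisliExt X.conv 𝔵 𝔵') (Y.conv 𝔶 y)) ≤ φ 𝔵 y := by
  simp only [kleisliExt_tens_le_iff, IsUModule, valueConv, le_qhom_iff, ultraHom_eq]
  constructor
  · rintro h 𝔵 _ _ y 𝔴 rfl rfl
    exact h 𝔴 (𝔵, y)
  · rintro h 𝔴 ⟨𝔵, y⟩
    exact h 𝔵 _ _ y 𝔴 rfl rfl

/-- The joint condition specialises to the left action at `𝔵' = 𝔵` and to the right action at `𝔶 =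
pure y`. Conversely, the right action is absorbed inside the extension by `tens_kleisliExt_le`, and
the left action finishes. -/
theorem isUModule_iff {X Y : ConvSpace.{u} V} (hX : IsSpace X) (hY : IsSpace Y) {φ : URel X Y} :
    IsUModule φ ↔ IsBimodule φ := by
  rw [isUModule_iff_kleisliExt]
  constructor
  · intro h
    refine ⟨fun 𝔵 𝔶 y => ?_, fun 𝔵 𝔵' y => ?_⟩
    · refine le_trans (tens_mono_right _ ?_) (h 𝔵 𝔵 𝔶 y)
      refine (unit_tens _).ge.trans (tens_mono (hX.unit_le_kleisliExt 𝔵) le_rfl)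
    · refine le_trans ?_ (h 𝔵 𝔵' (pure y) y)
      rw [tens_comm]
      refine tens_mono (le_kleisliExt_pure _ _ _) ?_
      exact (tens_unit _).ge.trans (tens_mono_right _ (hY.conv_pure y))
  · intro h 𝔵 𝔵' 𝔶 y
    refine le_trans ?_ (h.left 𝔵 𝔶 y)
    rw [← tens_assoc, tens_comm (kleisliExt φ 𝔵' 𝔶)]
    refine tens_mono ((tens_kleisliExt_le φ X.conv 𝔵 𝔵' 𝔶).trans ?_) le_rfl
    refine kleisliExt_mono (fun 𝔵 y => ?_) 𝔵 𝔶
    rw [kleisli_apply]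
    exact iSup_le fun 𝔵' => h.right 𝔵 𝔵' y

theorem kleisli_le_iff {X Y Z : ConvSpace.{u} V} {s : URel Y Z} {r : URel X Y} {t : URel X Z} :
    kleisli s r ≤ t ↔ ∀ 𝔵 𝔶 z, tens (kleisliExt r 𝔵 𝔶) (s 𝔶 z) ≤ t 𝔵 z := by
  simp only [Pi.le_def, kleisli_apply, iSup_le_iff]
  exact forall_congr' fun _ => forall_comm

theorem isBimodule_iff {X Y : ConvSpace.{u} V} {φ : URel X Y} :
    IsBimodule φ ↔ kleisli Y.conv φ ≤ φ ∧ kleisli φ X.conv ≤ φ :=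
  ⟨fun h => ⟨kleisli_le_iff.2 h.1, kleisli_le_iff.2 h.2⟩,
    fun h => ⟨kleisli_le_iff.1 h.1, kleisli_le_iff.1 h.2⟩⟩

theorem IsBimodule.comp {X Y Z : ConvSpace.{u} V} {ψ : URel Y Z} {φ : URel X Y}
    (hψ : IsBimodule ψ) (hφ : IsBimodule φ) : IsBimodule (kleisli ψ φ) := by
  rw [isBimodule_iff] at *
  constructor
  · rw [← kleisli_assoc]
    exact kleisli_mono hψ.1 le_rfl
  · rw [kleisli_assoc]
    exact kleisli_mono le_rfl hφ.2

theorem IsBimodule.conv_kleisli {X Y : ConvSpace.{u} V} (hY : IsSpace Y) {φ : URel X Y}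
    (hφ : IsBimodule φ) : kleisli Y.conv φ = φ := by
  refine le_antisymm (isBimodule_iff.1 hφ).1 fun 𝔵 y => ?_
  rw [kleisli_apply]
  refine le_iSup_of_le (pure y) ((tens_unit _).ge.trans ?_)
  exact tens_mono (le_kleisliExt_pure _ _ _) (hY.conv_pure y)

/-- The Yoneda lemma: composing with `f^*` restricts a module along `f`. -/
theorem IsBimodule.upperStar_kleisli {X Y Z : ConvSpace.{u} V} (hY : IsSpace Y) {φ : URel X Y}
    (hφ : IsBimodule φ) (f : Z → Y) :
    kleisli (upperStar f) φ = fun 𝔵 z => φ 𝔵 (f z) := by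
  funext 𝔵 z
  exact congrFun (congrFun (hφ.conv_kleisli hY) 𝔵) (f z)

/-- Transitivity is automatic because integrality makes `unit` the top element. -/
theorem isSpace_onePoint : IsSpace (onePoint.{u} V) :=
  ⟨fun _ => le_rfl, fun _ _ _ => le_top.trans (IsContinuous.unit_eq_top (V := V)).ge⟩

/-! ### The presheaf space -/

/-- Evaluation as a `U`-relation from `X` to a set of modules. -/
def evalRel (X : ConvSpace.{u} V) : URel X (presheafSpace X) := fun 𝔵 ψ => ψ.1 𝔵 PUnit.unit

/-- In the function-space formula it suffices to test the dual convergence at the join of the second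
projection, by reflexivity; the other values follow from the right action on `h`. -/
theorem le_presheafSpace_conv_iff {X : ConvSpace.{u} V} (hX : IsSpace X)
    {𝔭 : Ultrafilter (presheafSpace X)} {h : presheafSpace X} {v : V} :
    v ≤ (presheafSpace X).conv 𝔭 h ↔
      ∀ 𝔵, tens (kleisliExt (evalRel X) 𝔵 𝔭) v ≤ h.1 𝔵 PUnit.unit := by
  have hh := (isUModule_iff hX isSpace_onePoint).1 h.2
  simp only [kleisliExt_tens_le_iff]
  simp only [le_iInf_iff, valueConv, le_qhom_iff, ultraHom_eq]
  constructor
  · rintro H _ 𝔴 rfl rfl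
    refine le_trans (tens_mono_right _ ?_) (H (𝔴.map Prod.swap) rfl (ultraJoin (𝔴.map Prod.fst)))
    exact (unit_tens v).ge.trans (tens_mono (hX.unit_le_kleisliExt _) le_rfl)
  · rintro H 𝔴 rfl 𝔵
    refine le_trans ?_ (hh.right 𝔵 (ultraJoin (𝔴.map Prod.snd)) PUnit.unit)
    rw [← tens_assoc, tens_comm (xi _), tens_assoc]
    exact tens_mono_right _ (H _ (𝔴.map Prod.swap) rfl rfl)

/-- The space `Q` is a space of modules `X ⇸ 1` with the convergence of the function space, and `e`
is the evaluation relation. -/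
structure IsEvaluation {X Q : ConvSpace.{u} V} (e : URel X Q) : Prop where
  isBimodule : ∀ h : Q, IsBimodule (Y := onePoint.{u} V) fun 𝔵 _ => e 𝔵 h
  le_conv_iff : ∀ {𝔭 : Ultrafilter Q} {h : Q} {v : V},
    v ≤ Q.conv 𝔭 h ↔ ∀ 𝔵, tens (kleisliExt e 𝔵 𝔭) v ≤ e 𝔵 h

theorem isEvaluation_evalRel {X : ConvSpace.{u} V} (hX : IsSpace X) :
    IsEvaluation (evalRel X) :=
  ⟨fun h => (isUModule_iff hX isSpace_onePoint).1 h.2, le_presheafSpace_conv_iff hX⟩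

theorem isEvaluation_subSpace {X : ConvSpace.{u} V} (hX : IsSpace X) (s : Set (presheafSpace X)) :
    IsEvaluation (Q := subSpace (presheafSpace X) s) fun 𝔵 h => evalRel X 𝔵 h.1 := by
  refine ⟨fun h => (isEvaluation_evalRel hX).isBimodule h.1, fun {𝔭 h v} => ?_⟩
  exact (le_presheafSpace_conv_iff hX).trans
    (forall_congr' fun 𝔵 => by rw [kleisliExt_map_right]; rfl)

namespace IsEvaluation

variable {X Q D : ConvSpace.{u} V} {e : URel X Q}

omit [IsContinuous V] in
theorem kleisliExt_map_pointMap (he : IsEvaluation e) (𝔵 : Ultrafilter X) (h : Q)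
    (𝔲 : Ultrafilter (onePoint.{u} V)) : kleisliExt e 𝔵 (𝔲.map (pointMap h)) = e 𝔵 h := by
  rw [kleisliExt_map_right]
  exact (he.isBimodule h).kleisliExt_onePoint 𝔵 𝔲

omit [IsContinuous V] in
theorem isSpaceMap_pointMap (he : IsEvaluation e) (h : Q) :
    IsSpaceMap (onePoint.{u} V) Q (pointMap h) := by
  intro 𝔲 _
  rw [he.le_conv_iff]
  intro 𝔵
  rw [he.kleisliExt_map_pointMap, tens_unit]

/-- The convergence on `Q` is the largest relation acting on `e`, and two successive actions are
again an action; this is transitivity. -/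
theorem isSpace (he : IsEvaluation e) : IsSpace Q := by
  have h₁ : ∀ 𝔵 𝔭 h, tens (kleisliExt e 𝔵 𝔭) (Q.conv 𝔭 h) ≤ e 𝔵 h := fun 𝔵 𝔭 h =>
    he.le_conv_iff.1 le_rfl 𝔵
  refine ⟨fun h => he.isSpaceMap_pointMap h (pure PUnit.unit) PUnit.unit, fun 𝔭 𝔮 h => ?_⟩
  rw [he.le_conv_iff]
  intro 𝔵
  rw [← tens_assoc]
  refine (tens_mono ?_ le_rfl).trans (h₁ 𝔵 𝔮 h)
  exact (tens_kleisliExt_le Q.conv e 𝔵 𝔭 𝔮).trans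
    (kleisliExt_mono (kleisli_le_iff.2 h₁) 𝔵 𝔮)

-- Transposition: the left action says that `d` is a map, while the right action is automatic
-- because every point of `Q` is a module.
omit [IsContinuous V] in
theorem isSpaceMap_iff (he : IsEvaluation e) {d : D → Q} :
    IsSpaceMap D Q d ↔ IsBimodule (Y := D) fun 𝔵 δ => e 𝔵 (d δ) := by
  have key : ∀ 𝔡 δ, D.conv 𝔡 δ ≤ Q.conv (𝔡.map d) (d δ) ↔
      ∀ 𝔵, tens (kleisliExt (fun 𝔵 δ => e 𝔵 (d δ)) 𝔵 𝔡) (D.conv 𝔡 δ) ≤ e 𝔵 (d δ) := by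
    intro 𝔡 δ
    rw [he.le_conv_iff]
    simp only [kleisliExt_map_right]
  exact ⟨fun h => ⟨fun 𝔵 𝔡 δ => (key 𝔡 δ).1 (h 𝔡 δ) 𝔵,
    fun 𝔵 𝔵' δ => (he.isBimodule (d δ)).right 𝔵 𝔵' PUnit.unit⟩,
    fun h 𝔡 δ => (key 𝔡 δ).2 fun 𝔵 => h.left 𝔵 𝔡 δ⟩

omit [IsContinuous V] in
theorem le_lowerStar_pointMap_iff (he : IsEvaluation e) {x : Q} {χ : URel (onePoint.{u} V) Q} :
    χ ≤ lowerStar (pointMap x) ↔ ∀ 𝔵 𝔲 h, tens (e 𝔵 x) (χ 𝔲 h) ≤ e 𝔵 h := by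
  have : ∀ 𝔲 h, χ 𝔲 h ≤ lowerStar (pointMap x) 𝔲 h ↔
      ∀ 𝔵, tens (e 𝔵 x) (χ 𝔲 h) ≤ e 𝔵 h := by
    intro 𝔲 h
    rw [lowerStar, he.le_conv_iff]
    simp only [he.kleisliExt_map_pointMap]
  simp only [Pi.le_def, this]
  exact ⟨fun H 𝔵 𝔲 h => H 𝔲 h 𝔵, fun H 𝔲 h 𝔵 => H 𝔵 𝔲 h⟩

theorem kleisli_le_lowerStar_iff (he : IsEvaluation e) {d : D → Q}
    {ψ : URel D (onePoint.{u} V)} (hψ : IsBimodule ψ) {χ : URel (onePoint.{u} V) Q} :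
    kleisli χ ψ ≤ lowerStar d ↔ ∀ 𝔵 𝔲 h,
      tens (kleisli ψ (fun 𝔵 δ => e 𝔵 (d δ)) 𝔵 PUnit.unit) (χ 𝔲 h) ≤ e 𝔵 h := by
  rw [kleisli_le_iff]
  simp only [lowerStar, he.le_conv_iff, kleisliExt_map_right, kleisli_apply, iSup_tens,
    iSup_le_iff, hψ.kleisliExt_onePoint, tens_assoc]
  exact ⟨fun H 𝔵 𝔲 h 𝔡 => H 𝔡 𝔲 h 𝔵, fun H 𝔡 𝔲 h 𝔵 => H 𝔵 𝔲 h 𝔡⟩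

/-- Colimits in spaces of modules are computed by composition. -/
theorem isWeightedColimit (he : IsEvaluation e) {d : D → Q} {ψ : URel D (onePoint.{u} V)}
    (hψ : IsBimodule ψ) {x : Q}
    (hx : ∀ 𝔵, e 𝔵 x = kleisli ψ (fun 𝔵 δ => e 𝔵 (d δ)) 𝔵 PUnit.unit) :
    IsWeightedColimit d ψ x := by
  -- Both sides unfold to the same inequality, so `x_*` is largest among all `U`-relations
  -- satisfying the condition, not only among modules.
  have key : ∀ χ : URel (onePoint.{u} V) Q,
      kleisli χ ψ ≤ lowerStar d ↔ χ ≤ lowerStar (pointMap x) := fun χ => by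
    rw [he.kleisli_le_lowerStar_iff hψ, he.le_lowerStar_pointMap_iff]
    simp only [hx]
  refine ⟨⟨?_, (key _).2 le_rfl⟩, fun χ hχ => (key χ).1 hχ.2⟩
  exact (isUModule_iff isSpace_onePoint he.isSpace).2
    (isBimodule_lowerStar he.isSpace (he.isSpaceMap_pointMap x))

-- Greatest elements are unique, so `x_* = x'_*`; reflexivity at each point yields the two
-- inequalities of values.
omit [IsContinuous V] in
theorem eq_of_isWeightedColimit (he : IsEvaluation e) {d : D → Q} {ψ : URel D (onePoint.{u} V)}
    {x x' : Q} (hx : IsWeightedColimit d ψ x) (hx' : IsWeightedColimit d ψ x')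
    (𝔵 : Ultrafilter X) : e 𝔵 x = e 𝔵 x' := by
  have key : ∀ {x x' : Q}, IsWeightedColimit d ψ x → IsWeightedColimit d ψ x' →
      e 𝔵 x ≤ e 𝔵 x' := fun {x x'} hx hx' => by
    have h := (he.le_lowerStar_pointMap_iff.1 (hx.unique hx').ge) 𝔵 (pure PUnit.unit) x'
    refine le_trans ((tens_unit _).ge.trans (tens_mono_right _ ?_)) h
    exact he.isSpaceMap_pointMap x' (pure PUnit.unit) PUnit.unit
  exact le_antisymm (key hx hx') (key hx' hx)

end IsEvaluation

end Spaces

/-! ### Collages -/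

section Collage

variable {V : Type} [CompleteLattice V]

/-- The collage of a module `φ : X ⇸ Y`: the disjoint union of `X` and `Y` where `φ` measures the
convergence of ultrafilters on `X` to points of `Y`. -/
def collage {X Y : ConvSpace.{u} V} (φ : URel X Y) : ConvSpace.{u} V where
  carrier := X ⊕ Y
  conv 𝔠 z := z.elim (fun x => ⨆ (𝔵 : Ultrafilter X) (_ : 𝔵.map Sum.inl = 𝔠), X.conv 𝔵 x)
    (fun y => (⨆ (𝔵 : Ultrafilter X) (_ : 𝔵.map Sum.inl = 𝔠), φ 𝔵 y) ⊔
      ⨆ (𝔶 : Ultrafilter Y) (_ : 𝔶.map Sum.inr = 𝔠), Y.conv 𝔶 y)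

theorem Ultrafilter.map_injective {α β : Type u} {i : α → β} (hi : i.Injective) :
    Function.Injective (Ultrafilter.map i) := fun _ _ h =>
  Ultrafilter.coe_injective (Filter.map_injective hi (congrArg Ultrafilter.toFilter h))

theorem Ultrafilter.map_inl_ne_map_inr {α β : Type u} (𝔞 : Ultrafilter α) (𝔟 : Ultrafilter β) :
    𝔞.map (Sum.inl : α → α ⊕ β) ≠ 𝔟.map Sum.inr := fun h => by
  have h₁ : Set.range (Sum.inl : α → α ⊕ β) ∈ 𝔞.map (Sum.inl : α → α ⊕ β) := Filter.range_mem_map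
  have h₂ : Set.range (Sum.inr : β → α ⊕ β) ∈ 𝔞.map (Sum.inl : α → α ⊕ β) :=
    h ▸ (Filter.range_mem_map : _ ∈ Filter.map Sum.inr (𝔟 : Filter β))
  obtain ⟨_, ⟨a, rfl⟩, b, hb⟩ := Ultrafilter.nonempty_of_mem (Filter.inter_mem h₁ h₂)
  exact Sum.inr_ne_inl hb

theorem Ultrafilter.exists_eq_map_inl_or_inr {α β : Type u} (𝔠 : Ultrafilter (α ⊕ β)) :
    (∃ 𝔞 : Ultrafilter α, 𝔞.map Sum.inl = 𝔠) ∨ ∃ 𝔟 : Ultrafilter β, 𝔟.map Sum.inr = 𝔠 := by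
  have h : Sum.inl '' Set.univ ∪ Sum.inr '' Set.univ ∈ 𝔠 := by
    rw [Set.image_univ, Set.image_univ, Set.range_inl_union_range_inr]
    exact Filter.univ_mem
  refine (Ultrafilter.union_mem_iff.1 h).imp (fun h => ?_) fun h => ?_
  · obtain ⟨𝔞, h, -⟩ := exists_map_eq_of_image_mem Sum.inl_injective h
    exact ⟨𝔞, h⟩
  · obtain ⟨𝔟, h, -⟩ := exists_map_eq_of_image_mem Sum.inr_injective h
    exact ⟨𝔟, h⟩

variable {X Y : ConvSpace.{u} V} (φ : URel X Y)

/-- The inclusion of `X` into a collage. -/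
def collageInl : X → collage φ := Sum.inl

/-- The inclusion of `Y` into a collage. -/
def collageInr : Y → collage φ := Sum.inr

theorem collageInl_injective : Function.Injective (collageInl φ) := Sum.inl_injective

theorem collageInr_injective : Function.Injective (collageInr φ) := Sum.inr_injective

theorem collage_cases (z : collage φ) : (∃ x, collageInl φ x = z) ∨ ∃ y, collageInr φ y = z :=
  match z with
  | Sum.inl x => Or.inl ⟨x, rfl⟩
  | Sum.inr y => Or.inr ⟨y, rfl⟩

theorem collage_ultrafilter_cases (𝔠 : Ultrafilter (collage φ)) :
    (∃ 𝔵 : Ultrafilter X, 𝔵.map (collageInl φ) = 𝔠) ∨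
      ∃ 𝔶 : Ultrafilter Y, 𝔶.map (collageInr φ) = 𝔠 :=
  Ultrafilter.exists_eq_map_inl_or_inr 𝔠

theorem iSup_map_eq_map {α β : Type u} {i : α → β} (hi : i.Injective) (f : Ultrafilter α → V)
    (𝔞 : Ultrafilter α) : ⨆ (𝔟 : Ultrafilter α) (_ : 𝔟.map i = 𝔞.map i), f 𝔟 = f 𝔞 :=
  le_antisymm (iSup₂_le fun _ h => Ultrafilter.map_injective hi h ▸ le_rfl)
    (le_iSup₂_of_le 𝔞 rfl le_rfl)

theorem iSup_eq_bot_of_forall_ne {α β : Type u} {i : α → β} (f : Ultrafilter α → V)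
    {𝔟 : Ultrafilter β} (h : ∀ 𝔞 : Ultrafilter α, 𝔞.map i ≠ 𝔟) :
    ⨆ (𝔞 : Ultrafilter α) (_ : 𝔞.map i = 𝔟), f 𝔞 = ⊥ :=
  le_bot_iff.1 (iSup₂_le fun 𝔞 h' => (h 𝔞 h').elim)

theorem collage_conv_inl_inl (𝔵 : Ultrafilter X) (x : X) :
    (collage φ).conv (𝔵.map (collageInl φ)) (collageInl φ x) = X.conv 𝔵 x :=
  iSup_map_eq_map Sum.inl_injective (fun 𝔵 => X.conv 𝔵 x) 𝔵

theorem collage_conv_inl_inr (𝔵 : Ultrafilter X) (y : Y) :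
    (collage φ).conv (𝔵.map (collageInl φ)) (collageInr φ y) = φ 𝔵 y :=
  (congrArg₂ _ (iSup_map_eq_map Sum.inl_injective (fun 𝔵 => φ 𝔵 y) 𝔵)
    (iSup_eq_bot_of_forall_ne _ fun _ => (Ultrafilter.map_inl_ne_map_inr _ _).symm)).trans
    (sup_bot_eq _)

theorem collage_conv_inr_inl (𝔶 : Ultrafilter Y) (x : X) :
    (collage φ).conv (𝔶.map (collageInr φ)) (collageInl φ x) = ⊥ :=
  iSup_eq_bot_of_forall_ne _ fun _ => Ultrafilter.map_inl_ne_map_inr _ _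

theorem collage_conv_inr_inr (𝔶 : Ultrafilter Y) (y : Y) :
    (collage φ).conv (𝔶.map (collageInr φ)) (collageInr φ y) = Y.conv 𝔶 y :=
  (congrArg₂ _ (iSup_eq_bot_of_forall_ne _ fun _ => Ultrafilter.map_inl_ne_map_inr _ _)
    (iSup_map_eq_map Sum.inr_injective (fun 𝔶 => Y.conv 𝔶 y) 𝔶)).trans (bot_sup_eq _)

variable [TruthQuantale V]

/-- Transitivity is checked by sides: within `X` or within `Y` it is inherited, the two mixed cases
ending in `Y` are the right and left actions on `φ`, and passing from `Y` back to `X` has value `⊥`.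
-/
theorem isSpace_collage {φ : URel X Y} (hX : IsSpace X) (hY : IsSpace Y) (hφ : IsBimodule φ) :
    IsSpace (collage φ) := by
  refine ⟨?_, ?_⟩
  · rintro (x | y)
    · exact (hX.conv_pure x).trans (collage_conv_inl_inl φ (pure x) x).ge
    · exact (hY.conv_pure y).trans (collage_conv_inr_inr φ (pure y) y).ge
  · have hinl {Z : Type u} (j : Z → collage φ) := kleisliExt_map (V := V) (collageInl_injective φ) j
    have hinr {Z : Type u} (j : Z → collage φ) := kleisliExt_map (V := V) (collageInr_injective φ) j
    intro 𝔠 𝔡 z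
    obtain ⟨𝔵, rfl⟩ | ⟨𝔵, rfl⟩ := collage_ultrafilter_cases φ 𝔠 <;>
    obtain ⟨𝔶, rfl⟩ | ⟨𝔶, rfl⟩ := collage_ultrafilter_cases φ 𝔡
    · rw [hinl]
      simp only [collage_conv_inl_inl]
      obtain ⟨x, rfl⟩ | ⟨y, rfl⟩ := collage_cases φ z
      · simpa only [collage_conv_inl_inl] using hX.conv_trans 𝔵 𝔶 x
      · simpa only [collage_conv_inl_inr] using hφ.right 𝔵 𝔶 y
    · rw [hinl]
      simp only [collage_conv_inl_inr]
      obtain ⟨x, rfl⟩ | ⟨y, rfl⟩ := collage_cases φ z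
      · simp only [collage_conv_inr_inl, tens_bot, bot_le]
      · simpa only [collage_conv_inr_inr, collage_conv_inl_inr] using hφ.left 𝔵 𝔶 y
    · have : kleisliExt (collage φ).conv (𝔵.map (collageInr φ)) (𝔶.map (collageInl φ)) = ⊥ := by
        rw [hinr]
        simp only [collage_conv_inr_inl]
        refine le_bot_iff.1 ((kleisliExt_le Filter.univ_mem Filter.univ_mem).trans (sSup_le ?_))
        rintro _ ⟨_, _, rfl⟩
        exact le_rfl
      rw [this, bot_tens]
      exact bot_le
    · rw [hinr]
      simp only [collage_conv_inr_inr]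
      obtain ⟨x, rfl⟩ | ⟨y, rfl⟩ := collage_cases φ z
      · simp only [collage_conv_inr_inl, tens_bot, bot_le]
      · simpa only [collage_conv_inr_inr] using hY.conv_trans 𝔵 𝔶 y

end Collage

/-! ### Saturated families -/

namespace ModuleFamily

variable {V : Type} [CompleteLattice V] [TruthQuantale V] [IsContinuous V]
  {S : Type (u + 1)} {c : S → ConvSpace.{u} V}

/-- `Φ` is stable under composition with the modules in `Φ-Mod`. -/
def IsClosedUnderMod (Φ : ModuleFamily c) : Prop :=
  ∀ (X Y : S) (φ : URel (c X) (c Y)) (ψ : URel (c Y) (onePoint.{u} V)),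
    Φ.InMod X Y φ → ψ ∈ Φ.mem Y → kleisli ψ φ ∈ Φ.mem X

variable (hc : ∀ X, IsSpace (c X)) (hS : ∀ Y : ConvSpace.{u} V, IsSpace Y → ∃ X, c X = Y)
  (Φ : ModuleFamily c)
include hc

theorem isBimodule {X : S} {ψ : URel (c X) (onePoint.{u} V)} (hψ : ψ ∈ Φ.mem X) :
    IsBimodule ψ :=
  (isUModule_iff (hc X) isSpace_onePoint).1 (Φ.isUModule X ψ hψ)

/-- By the Yoneda lemma, `y^* ∘ φ` is just the restriction of `φ` to the point `y`. -/
theorem inMod_iff {X Y : S} {φ : URel (c X) (c Y)} : Φ.InMod X Y φ ↔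
    IsBimodule φ ∧ ∀ y : c Y, (fun 𝔵 _ => φ 𝔵 y : URel (c X) (onePoint.{u} V)) ∈ Φ.mem X := by
  rw [InMod, isUModule_iff (hc X) (hc Y)]
  refine and_congr_right fun hφ => forall_congr' fun y => ?_
  rw [hφ.upperStar_kleisli (hc Y)]

theorem inMod_upperStar {X Y : S} {f : c X → c Y} (hf : IsSpaceMap (c X) (c Y) f) :
    Φ.InMod Y X (upperStar f) :=
  (Φ.inMod_iff hc).2 ⟨isBimodule_upperStar (hc Y) hf, fun x => Φ.representable Y (f x)⟩

theorem IsClosedUnderMod.isSubcategory {Φ : ModuleFamily c} (h : Φ.IsClosedUnderMod) :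
    Φ.IsSubcategory := by
  refine ⟨fun X => (Φ.inMod_iff hc).2 ⟨(hc X).isBimodule_conv, Φ.representable X⟩,
    fun X Y Z φ ψ hφ hψ => ?_⟩
  have hψ' := (Φ.inMod_iff hc).1 hψ
  exact (Φ.inMod_iff hc).2 ⟨hψ'.1.comp ((Φ.inMod_iff hc).1 hφ).1,
    fun z => h X Y φ _ hφ (hψ'.2 z)⟩

theorem IsClosedUnderMod.isStable {Φ : ModuleFamily c} (h : Φ.IsClosedUnderMod) :
    Φ.IsStable := fun X Y _ hψ =>
  ⟨fun _ hf => h Y X _ _ (Φ.inMod_upperStar hc hf) hψ, fun _ _ hg => h Y X _ _ hg hψ⟩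

theorem IsClosedUnderMod.saturated {Φ : ModuleFamily c} (h : Φ.IsClosedUnderMod) :
    Φ.Saturated := by
  intro X D d ψ hd hψ
  have he := isEvaluation_subSpace (hc X) {ψ | ψ.1 ∈ Φ.mem X}
  have hb := Φ.isBimodule hc hψ
  -- The transpose of `d` lies in Mod(Φ) since its values are points of Φ[X]; hence the composite,
  -- which is the colimit, stays in Φ[X].
  have hmem : kleisli ψ (fun 𝔵 δ => (d δ).1.1 𝔵 PUnit.unit) ∈ Φ.mem X :=
    h X D _ ψ ((Φ.inMod_iff hc).2 ⟨he.isSpaceMap_iff.1 hd, fun δ => (d δ).2⟩) hψ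
  have hcolim := he.isWeightedColimit (d := d) hb (x := ⟨⟨_, Φ.isUModule X _ hmem⟩, hmem⟩)
    fun _ => rfl
  refine ⟨⟨_, hcolim⟩, fun χ hχ => ?_⟩
  exact (isEvaluation_evalRel (hc X)).isWeightedColimit hb
    fun 𝔵 => he.eq_of_isWeightedColimit hχ hcolim 𝔵

theorem Saturated.isClosedUnderMod {Φ : ModuleFamily c} (h : Φ.Saturated) :
    Φ.IsClosedUnderMod := by
  intro X Y φ ψ hφ hψ
  obtain ⟨hφ, hφ'⟩ := (Φ.inMod_iff hc).1 hφ
  have hb := Φ.isBimodule hc hψ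
  have he := isEvaluation_evalRel (hc X)
  have hψφ : IsUModule (kleisli ψ φ) :=
    (isUModule_iff (hc X) isSpace_onePoint).2 (hb.comp hφ)
  let d : c Y → Φ.space X := fun y => ⟨⟨_, Φ.isUModule X _ (hφ' y)⟩, hφ' y⟩
  have hd : IsSpaceMap (c Y) (Φ.space X) d := (isEvaluation_subSpace (hc X) _).isSpaceMap_iff.2 hφ
  obtain ⟨⟨χ, hχ⟩, hpres⟩ := h X Y d ψ hd hψ
  have hcolim : IsWeightedColimit (Φ.incl X ∘ d) ψ (⟨_, hψφ⟩ : presheafSpace (c X)) :=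
    he.isWeightedColimit hb fun _ => rfl
  -- Preservation makes `χ` a colimit in PX, where `ψ ∘ φ` is one too.
  have heq : χ.1.1 = kleisli ψ φ :=
    funext fun 𝔵 => funext fun _ => he.eq_of_isWeightedColimit (hpres χ hχ) hcolim 𝔵
  exact heq ▸ χ.2

include hS

theorem IsSubcategory.isClosedUnderMod {Φ : ModuleFamily c} (h : Φ.IsSubcategory) :
    Φ.IsClosedUnderMod := by
  intro X Y φ ψ hφ hψ
  obtain ⟨s, hs⟩ := hS (onePoint.{u} V) isSpace_onePoint
  -- `c s` equals the one-point space only propositionally; generalising to a variable `Z` allows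
  -- substitution.
  have hb : ∀ Z : ConvSpace.{u} V, Z = onePoint.{u} V →
      IsBimodule (fun 𝔶 _ => ψ 𝔶 PUnit.unit : URel (c Y) Z) := by
    rintro _ rfl
    exact Φ.isBimodule hc hψ
  have hne : ∀ Z : ConvSpace.{u} V, Z = onePoint.{u} V → Nonempty Z := by
    rintro _ rfl
    exact ⟨PUnit.unit⟩
  obtain ⟨z⟩ := hne _ hs
  have hψ' : Φ.InMod Y s fun 𝔶 _ => ψ 𝔶 PUnit.unit :=
    (Φ.inMod_iff hc).2 ⟨hb _ hs, fun _ => hψ⟩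
  exact ((Φ.inMod_iff hc).1 (h.2 X Y s φ _ hφ hψ')).2 z

-- Listing the properties of the inclusions keeps the equality between `c Z` and the collage out of
-- later arguments.
omit [IsContinuous V] in
theorem exists_collage {X Y : S} {φ : URel (c X) (c Y)} (hφ : IsBimodule φ) :
    ∃ (Z : S) (i : c X → c Z) (j : c Y → c Z),
      (∀ 𝔵 x, (c Z).conv (𝔵.map i) (i x) = (c X).conv 𝔵 x) ∧
      (∀ 𝔵 y, (c Z).conv (𝔵.map i) (j y) = φ 𝔵 y) ∧
      (∀ 𝔶 y, (c Z).conv (𝔶.map j) (j y) = (c Y).conv 𝔶 y) ∧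
      ∀ z, (∃ x, i x = z) ∨ ∃ y, j y = z := by
  obtain ⟨Z, hZ⟩ := hS _ (isSpace_collage (hc X) (hc Y) hφ)
  refine ⟨Z, ?_⟩
  rw [hZ]
  exact ⟨collageInl φ, collageInr φ, collage_conv_inl_inl φ, collage_conv_inl_inr φ,
    collage_conv_inr_inr φ, collage_cases φ⟩

theorem IsStable.isClosedUnderMod {Φ : ModuleFamily c} (h : Φ.IsStable) :
    Φ.IsClosedUnderMod := by
  intro X Y φ ψ hφ hψ
  obtain ⟨hφ, hφ'⟩ := (Φ.inMod_iff hc).1 hφ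
  obtain ⟨Z, i, j, hii, hij, hjj, hZ⟩ := exists_collage hc hS hφ
  have hi : IsSpaceMap (c X) (c Z) i := fun 𝔵 x => (hii 𝔵 x).ge
  have hj : IsSpaceMap (c Y) (c Z) j := fun 𝔶 y => (hjj 𝔶 y).ge
  have hbi := isBimodule_lowerStar (hc Z) hi
  -- At points of `X` the module `i_*` is representable, and at points of `Y` it restricts to `φ`.
  have hi' : Φ.InMod X Z (lowerStar i) := by
    refine (Φ.inMod_iff hc).2 ⟨hbi, fun z => ?_⟩
    obtain ⟨x, rfl⟩ | ⟨y, rfl⟩ := hZ z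
    · simp only [lowerStar, hii]
      exact Φ.representable X x
    · simp only [lowerStar, hij]
      exact hφ' y
  have hcomp : kleisli (upperStar j) (lowerStar i) = φ := by
    rw [hbi.upperStar_kleisli (hc Z)]
    exact funext fun 𝔵 => funext fun y => hij 𝔵 y
  rw [← hcomp, ← kleisli_assoc]
  exact (h Z X _ ((h Y Z ψ hψ).1 j hj)).2 i hi hi'

theorem tfae : List.TFAE [Φ.Saturated, Φ.IsSubcategory, Φ.IsStable] := by
  tfae_have 1 → 2 := fun h => (h.isClosedUnderMod hc).isSubcategory hc
  tfae_have 2 → 3 := fun h => (h.isClosedUnderMod hc hS).isStable hc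
  tfae_have 3 → 1 := fun h => (h.isClosedUnderMod hc hS).saturated hc
  tfae_finish

end ModuleFamily

/-! ### Topological spaces and approach spaces -/

theorem isSpace_topConv (X : TopCat.{u}) : IsSpace (topConv X) := by
  refine isSpace_iff.2 ⟨fun x _ => pure_le_nhds x, fun 𝔛 𝔵 x h => ?_⟩
  obtain ⟨h𝔛, h𝔵 : (𝔵 : Filter X) ≤ nhds x⟩ := h
  refine (nhds_basis_opens x).ge_iff.2 fun O hO => ?_
  by_contra hO'
  -- Some ultrafilter omitting `O` would converge to a point of the open set `O`.
  have hA : {𝔶 : Ultrafilter X | O ∉ 𝔶} ∈ 𝔛 := Ultrafilter.compl_mem_iff_notMem.2 hO'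
  have hB : O ∈ 𝔵 := h𝔵 (hO.2.mem_nhds hO.1)
  simp only [ultraExt, iInf_Prop_eq, iSup_Prop_eq] at h𝔛
  obtain ⟨𝔶, h𝔶, y, hy, hy'⟩ := h𝔛 _ hA _ hB
  exact h𝔶 (hy' (hO.2.mem_nhds hy))

/-- Reflexive and transitive ultrafilter relations are convergence relations of topologies. -/
theorem exists_topConv_eq (Y : ConvSpace.{u} Prop) (hY : IsSpace Y) : ∃ X, topConv X = Y := by
  -- The limits of ultrafilters containing `A` form a closed set: the closure operator is
  -- idempotent.
  have hcl : ∀ (A : Set Y) (𝔶 : Ultrafilter Y) (y : Y),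
      {y | ∃ 𝔵 : Ultrafilter Y, A ∈ 𝔵 ∧ Y.conv 𝔵 y} ∈ 𝔶 → Y.conv 𝔶 y →
        ∃ 𝔵 : Ultrafilter Y, A ∈ 𝔵 ∧ Y.conv 𝔵 y := fun A 𝔶 y h hy => by
    obtain ⟨𝔵, hA, h𝔵⟩ := exists_le_kleisliExt (v := True) (r := Y.conv) (𝔶 := 𝔶) (A := A)
      (by simpa using h)
    exact ⟨𝔵, hA, hY.conv_trans 𝔵 𝔶 y ⟨h𝔵 trivial, hy⟩⟩
  let t : TopologicalSpace Y :=
    { IsOpen := fun O => ∀ y ∈ O, ∀ 𝔶 : Ultrafilter Y, Y.conv 𝔶 y → O ∈ 𝔶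
      isOpen_univ := fun _ _ _ _ => Filter.univ_mem
      isOpen_inter := fun O O' h h' y hy 𝔶 h𝔶 =>
        Filter.inter_mem (h y hy.1 𝔶 h𝔶) (h' y hy.2 𝔶 h𝔶)
      isOpen_sUnion := fun s h y ⟨O, hO, hy⟩ 𝔶 h𝔶 =>
        Filter.mem_of_superset (h O hO y hy 𝔶 h𝔶) (Set.subset_sUnion_of_mem hO) }
  refine ⟨@TopCat.of Y t, ?_⟩
  have hconv : ∀ (𝔶 : Ultrafilter Y) (y : Y), (𝔶 : Filter Y) ≤ @nhds Y t y ↔ Y.conv 𝔶 y := by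
    refine fun 𝔶 y => ⟨fun h => ?_, fun h => ?_⟩
    · refine hY.conv_trans 𝔶 (pure y) y ⟨?_, hY.conv_pure y trivial⟩
      have : True ≤ kleisliExt Y.conv 𝔶 (pure y) := by
        refine le_kleisliExt fun A hA B hB _ => ?_
        -- `y` must lie in the closure of `A`: otherwise the complement of that closure is an open
        -- neighbourhood of `y`, hence belongs to `𝔶`, and so meets `A`.
        by_cases hy : ∃ 𝔵 : Ultrafilter Y, A ∈ 𝔵 ∧ Y.conv 𝔵 y
        · obtain ⟨𝔵, h𝔵, h⟩ := hy
          have hmem : Y.conv 𝔵 y ∈ (fun p : Ultrafilter Y × Y => Y.conv p.1 p.2) ''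
              {p | A ∈ p.1 ∧ p.2 ∈ B} := ⟨(𝔵, y), ⟨h𝔵, hB⟩, rfl⟩
          exact le_sSup hmem h
        · have hO : @IsOpen Y t {y | ¬ ∃ 𝔵 : Ultrafilter Y, A ∈ 𝔵 ∧ Y.conv 𝔵 y} :=
            fun z hz 𝔷 h𝔷 => Ultrafilter.compl_mem_iff_notMem.2 fun h' => hz (hcl A 𝔷 z h' h𝔷)
          obtain ⟨z, hz, hzA⟩ := 𝔶.nonempty_of_mem
            (Filter.inter_mem (h (@IsOpen.mem_nhds Y t _ _ hO hy)) hA)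
          exact (hz ⟨pure z, hzA, hY.conv_pure z trivial⟩).elim
      exact this trivial
    · refine (@nhds_basis_opens Y t y).ge_iff.2 fun O hO => hO.2 y hO.1 𝔶 h
  obtain ⟨carrier, conv⟩ := Y
  exact congrArg (ConvSpace.mk carrier) (funext fun 𝔶 => funext fun y => propext (hconv 𝔶 y))

theorem isSpace_appConv (X : ApproachSpace.{u}) : IsSpace (appConv X) :=
  isSpace_iff.2 ⟨X.conv_pure, X.conv_join⟩

theorem exists_appConv_eq (Y : ConvSpace.{u} ℝ≥0∞ᵒᵈ) (hY : IsSpace Y) : ∃ X, appConv X = Y :=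
  ⟨⟨Y, (isSpace_iff.1 hY).1, (isSpace_iff.1 hY).2⟩, rfl⟩

theorem mainTheorem11 :
    (∀ Φ : ModuleFamily topConv.{u},
      List.TFAE [Φ.Saturated, Φ.IsSubcategory, Φ.IsStable]) ∧
    (∀ Φ : ModuleFamily appConv.{u},
      List.TFAE [Φ.Saturated, Φ.IsSubcategory, Φ.IsStable]) :=
  ⟨fun Φ => Φ.tfae isSpace_topConv exists_topConv_eq,
    fun Φ => Φ.tfae isSpace_appConv exists_appConv_eq⟩
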